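/- Let $\Omega$ be a nonempty set and let $\mathbb{K}$ be a nonempty set of maps (processes) $z:\mathbb{R}_{\ge 0}\to\Omega$ such that $z(k+t)=z(k)$ for all $k\in\{0,1,2,\dots\}$, $t\in(0,1)$ (so a process is the same thing as a sequence in $\Omega$). Let $g:\Omega\to[0,1]$. Let $\mathfrak{U}$ be the set of all bounded functions $\Omega\to\mathbb{R}$, and let $\mathfrak{C}$ be a nonempty set of functions $\mathbb{K}\to\mathbb{R}$ such that $Ac+B\in\mathfrak{C}$ whenever $c\in\mathfrak{C}$, $A\ge 0$, $B\in\mathbb{R}$. Let $V:\mathfrak{C}\to\mathfrak{U}$ be a game value map, that is, $V[Ac+B]=A\,V[c]+B$ for all $c\in\mathfrak{C}$, $A\ge0$, $B\in\mathbb{R}$, and $V[c_1]\le V[c_2]$ pointwise on $\Omega$ whenever $c_1,c_2\in\mathfrak{C}$ and $c_1\le c_2$ pointwise on $\mathbb{K}$. For integers $n\ge1$ and $\mu\in(0,1)$ put $$\bar v_n(z)=\frac1n\sum_{t=0}^{n-1}g(z(t)),\qquad \bar w_\mu(z)=\mu\sum_{t=0}^{\infty}(1-\mu)^t g(z(t))\qquad(z\in\mathbb{K}),$$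 and assume that $\bar v_n,\bar w_\mu\in\mathfrak{C}$ for all such $n,\mu$. Assume that both families enjoy the Dynamic Programming Principle: * for all integers $n,h\ge 1$, the payoff $z\mapsto \frac{1}{n+h}\sum_{t=0}^{h-1}g(z(t))+\frac{n}{n+h}V[\bar v_n](z(h))$ lies in $\mathfrak{C}$, and its image under $V$ is $V[\bar v_{n+h}]$; * for all $\mu\in(0,1)$ and all integers $h\ge1$, the payoff $z\mapsto \mu\sum_{t=0}^{h-1}(1-\mu)^t g(z(t))+(1-\mu)^hV[\bar w_\mu](z(h))$ lies in $\mathfrak{C}$, and its image under $V$ is $V[\bar w_\mu]$. Then the following two statements are equivalent: 1. the sequence of functions $V[\bar v_n]$ converges uniformly on $\Omega$ as $n\to\infty$; 2. the family of functions $V[\bar w_\mu]$ $(0<\mu<1)$ converges uniformly on $\Omega$ as $\mu\downarrow0$. Moreover, when at least one of these statements holds, $\lim_{n\to\infty}V[\bar v_n](\omega)=\lim_{\mu\downarrow0}V[\bar w_\mu](\omega)$ for all $\omega\in\Omega$. -/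

import Mathlib

open Set Filter Topology
open scoped NNReal

namespace TauberianGame

universe u

/-- A process in discrete time, regarded as a map on `ℝ₊`: it is constant on each interval
`[k, k+1)`, `k = 0, 1, 2, …`. -/
def IsDiscreteProcess {Ω : Type u} (z : ℝ≥0 → Ω) : Prop :=
  ∀ k : ℕ, ∀ t : ℝ≥0, 0 < t → t < 1 → z ((k : ℝ≥0) + t) = z (k : ℝ≥0)

/-- The payoffs form a non-empty set of maps from `K` to `ℝ` that is closed under
`c ↦ A c + B`, `A ≥ 0`. -/
structure IsPayoffClass {Ω : Type u} {K : Set (ℝ≥0 → Ω)} (C : Set (K → ℝ)) : Prop where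
  nonempty : C.Nonempty
  affine_mem : ∀ c ∈ C, ∀ A B : ℝ, 0 ≤ A → (fun z => A * c z + B) ∈ C

/-- `V` is a game value map from `C` to the bounded functions on `Ω`. Only the values of `V` on
`C` are constrained (and only these are ever used). -/
structure IsGameValueMap {Ω : Type u} {K : Set (ℝ≥0 → Ω)} (C : Set (K → ℝ))
    (V : (K → ℝ) → Ω → ℝ) : Prop where
  bounded : ∀ c ∈ C, ∃ M : ℝ, ∀ ω, |V c ω| ≤ M
  affine : ∀ c ∈ C, ∀ A B : ℝ, 0 ≤ A → ∀ ω, V (fun z => A * c z + B) ω = A * V c ω + B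
  mono : ∀ c₁ ∈ C, ∀ c₂ ∈ C, (∀ z, c₁ z ≤ c₂ z) → ∀ ω, V c₁ ω ≤ V c₂ ω

/-- The averaged payoff `(1/n) ∑_{t<n} g(z(t))` (meaningful for `n ≥ 1`). -/
noncomputable def avgPayoff {Ω : Type u} (K : Set (ℝ≥0 → Ω)) (g : Ω → ℝ) (n : ℕ) : K → ℝ :=
  fun z => (1 / (n : ℝ)) * ∑ t ∈ Finset.range n, g (z.1 (t : ℝ≥0))

/-- The discounted payoff `μ ∑_{t≥0} (1-μ)^t g(z(t))` (for `0 < μ < 1` and bounded `g` the series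
converges absolutely). -/
noncomputable def discPayoff {Ω : Type u} (K : Set (ℝ≥0 → Ω)) (g : Ω → ℝ) (μ : ℝ) : K → ℝ :=
  fun z => μ * ∑' t : ℕ, (1 - μ) ^ t * g (z.1 (t : ℝ≥0))

/-- The payoff `1/(n+h) ∑_{t<h} g(z(t)) + n/(n+h) U(z(h))`. -/
noncomputable def avgStep {Ω : Type u} (K : Set (ℝ≥0 → Ω)) (g : Ω → ℝ) (n h : ℕ) (U : Ω → ℝ) :
    K → ℝ :=
  fun z => (1 / ((n : ℝ) + (h : ℝ))) * ∑ t ∈ Finset.range h, g (z.1 (t : ℝ≥0))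
    + ((n : ℝ) / ((n : ℝ) + (h : ℝ))) * U (z.1 (h : ℝ≥0))

/-- The payoff `μ ∑_{t<h} (1-μ)^t g(z(t)) + (1-μ)^h U(z(h))`. -/
noncomputable def discStep {Ω : Type u} (K : Set (ℝ≥0 → Ω)) (g : Ω → ℝ) (μ : ℝ) (h : ℕ)
    (U : Ω → ℝ) : K → ℝ :=
  fun z => μ * ∑ t ∈ Finset.range h, (1 - μ) ^ t * g (z.1 (t : ℝ≥0))
    + (1 - μ) ^ h * U (z.1 (h : ℝ≥0))

/-- The Dynamic Programming Principle for the averaged payoffs. -/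
def AvgDPP {Ω : Type u} {K : Set (ℝ≥0 → Ω)} (g : Ω → ℝ) (C : Set (K → ℝ))
    (V : (K → ℝ) → Ω → ℝ) : Prop :=
  ∀ n h : ℕ, 1 ≤ n → 1 ≤ h →
    avgStep K g n h (V (avgPayoff K g n)) ∈ C ∧
    V (avgStep K g n h (V (avgPayoff K g n))) = V (avgPayoff K g (n + h))

/-- The Dynamic Programming Principle for the discounted payoffs. -/
def DiscDPP {Ω : Type u} {K : Set (ℝ≥0 → Ω)} (g : Ω → ℝ) (C : Set (K → ℝ))
    (V : (K → ℝ) → Ω → ℝ) : Prop :=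
  ∀ μ : ℝ, 0 < μ → μ < 1 → ∀ h : ℕ, 1 ≤ h →
    discStep K g μ h (V (discPayoff K g μ)) ∈ C ∧
    V (discStep K g μ h (V (discPayoff K g μ))) = V (discPayoff K g μ)

end TauberianGame

/-! Both dynamic programming principles run over the same `h` stages, and a game value map is
nonexpansive for the sup distance, so |V[v̄_m] − V[w̄_μ]| is at most the distance of the two step
payoffs. With n = m − h and μ ≈ 1/m, their stage weights differ little, and the gap in continuation
values is damped by n/m. Taking h = ⌊m/p⌋ gives a contraction by 1 − 1/(2p) with error 4/p²
(`StepComparison.contraction`). The error is quadratic in 1/p and the gain linear, so the fixed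
point is O(1/p), arbitrarily small. Uniform convergence of either family pays for the shift of
horizon from n to m. -/

namespace TauberianGame

/-! ### Game values and the one-step comparison -/

section Value

variable {Ω : Type*} {K : Set (ℝ≥0 → Ω)} {C : Set (K → ℝ)} {V : (K → ℝ) → Ω → ℝ}

/-- A game value map is nonexpansive for the uniform distance. -/
theorem IsGameValueMap.abs_sub_le (hC : IsPayoffClass C) (hV : IsGameValueMap C V)
    {c₁ c₂ : K → ℝ} (h₁ : c₁ ∈ C) (h₂ : c₂ ∈ C) {e : ℝ} (h : ∀ z, |c₁ z - c₂ z| ≤ e) (ω : Ω) :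
    |V c₁ ω - V c₂ ω| ≤ e := by
  have key : ∀ {a b : K → ℝ}, a ∈ C → b ∈ C → (∀ z, a z ≤ b z + e) → V a ω ≤ V b ω + e := by
    intro a b ha hb hab
    have h1 := hV.mono a ha _ (hC.affine_mem b hb 1 e zero_le_one)
      (fun z => by simpa using hab z) ω
    rw [hV.affine b hb 1 e zero_le_one ω] at h1
    simpa using h1
  rw [abs_le]
  have h3 := key h₁ h₂ (fun z => by linarith [(abs_le.1 (h z)).2])
  have h4 := key h₂ h₁ (fun z => by linarith [(abs_le.1 (h z)).1])
  constructor <;> linarith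

/-- The value of a payoff with values in `[0, 1]` lies in `[0, 1]`. -/
theorem IsGameValueMap.mem_Icc (hC : IsPayoffClass C) (hV : IsGameValueMap C V)
    {c : K → ℝ} (hc : c ∈ C) (h : ∀ z, c z ∈ Icc (0 : ℝ) 1) (ω : Ω) :
    V c ω ∈ Icc (0 : ℝ) 1 := by
  -- With A = 0 the constant payoff B is in the class and has value B.
  have hm := fun B : ℝ => hC.affine_mem c hc 0 B le_rfl
  have hv := fun B : ℝ => hV.affine c hc 0 B le_rfl ω
  have h0 := hV.mono _ (hm 0) c hc (fun z => by simpa using (h z).1) ω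
  have h1 := hV.mono c hc _ (hm 1) (fun z => by simpa using (h z).2) ω
  rw [hv] at h0 h1
  exact ⟨by linarith, by linarith⟩

theorem avgPayoff_mem_Icc {g : Ω → ℝ} (hg : ∀ ω, g ω ∈ Icc (0 : ℝ) 1) (n : ℕ) (z : K) :
    avgPayoff K g n z ∈ Icc (0 : ℝ) 1 := by
  have h0 : 0 ≤ ∑ t ∈ Finset.range n, g (z.1 (t : ℝ≥0)) :=
    Finset.sum_nonneg fun t _ => (hg _).1
  have h1 : ∑ t ∈ Finset.range n, g (z.1 (t : ℝ≥0)) ≤ n := by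
    simpa using Finset.sum_le_sum (s := Finset.range n) (fun t _ => (hg (z.1 (t : ℝ≥0))).2)
  refine ⟨mul_nonneg (by positivity) h0, ?_⟩
  simp only [avgPayoff, one_div, inv_mul_eq_div]
  exact div_le_one_of_le₀ h1 (by positivity)

theorem discPayoff_mem_Icc {g : Ω → ℝ} (hg : ∀ ω, g ω ∈ Icc (0 : ℝ) 1) {μ : ℝ}
    (h0 : 0 < μ) (h1 : μ < 1) (z : K) : discPayoff K g μ z ∈ Icc (0 : ℝ) 1 := by
  have hn : 0 ≤ 1 - μ := by linarith
  have hgeo := hasSum_geometric_of_lt_one hn (by linarith : 1 - μ < 1)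
  have hle : ∀ t : ℕ, (1 - μ) ^ t * g (z.1 (t : ℝ≥0)) ≤ (1 - μ) ^ t := fun t =>
    mul_le_of_le_one_right (by positivity) (hg _).2
  have hge : ∀ t : ℕ, 0 ≤ (1 - μ) ^ t * g (z.1 (t : ℝ≥0)) := fun t =>
    mul_nonneg (by positivity) (hg _).1
  refine ⟨mul_nonneg h0.le (tsum_nonneg hge), ?_⟩
  have := (Summable.of_nonneg_of_le hge hle hgeo.summable).tsum_le_tsum hle hgeo.summable
  rw [hgeo.tsum_eq] at this
  calc discPayoff K g μ z ≤ μ * (1 - (1 - μ))⁻¹ := mul_le_mul_of_nonneg_left this h0.le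
    _ = 1 := by rw [sub_sub_cancel, mul_inv_cancel₀ h0.ne']

/-- The discounted weights `μ (1 - μ) ^ t`, `t < h`, are close to the constant weights `a`. -/
theorem sum_abs_disc_weight_sub_le {μ : ℝ} (h0 : 0 < μ) (h1 : μ < 1) (a : ℝ) (h : ℕ) :
    ∑ t ∈ Finset.range h, |μ * (1 - μ) ^ t - a| ≤ h * |μ - a| + (h * μ) ^ 2 := by
  have hb : ∀ t ∈ Finset.range h, |μ * (1 - μ) ^ t - a| ≤ |μ - a| + h * μ ^ 2 := by
    intro t ht
    have hth : (t : ℝ) ≤ h := by exact_mod_cast (Finset.mem_range.1 ht).le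
    -- Bernoulli: 1 − (1 − μ)^t ≤ tμ.
    have hB := one_add_mul_le_pow (by linarith : (-2 : ℝ) ≤ -μ) t
    have hp : (1 - μ) ^ t ≤ 1 := pow_le_one₀ (by linarith) (by linarith)
    rw [← sub_eq_add_neg] at hB
    have h2 : |μ * (1 - μ) ^ t - μ| ≤ h * μ ^ 2 := by
      rw [abs_le]
      constructor
      · nlinarith [mul_le_mul_of_nonneg_left hB h0.le,
          mul_le_mul_of_nonneg_right hth (sq_nonneg μ)]
      · have : μ * (1 - μ) ^ t ≤ μ := mul_le_of_le_one_right h0.le hp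
        have : 0 ≤ h * μ ^ 2 := by positivity
        linarith
    linarith [abs_sub_le (μ * (1 - μ) ^ t) μ a]
  calc _ ≤ ∑ t ∈ Finset.range h, (|μ - a| + h * μ ^ 2) := Finset.sum_le_sum hb
    _ = _ := by simp; ring

/-- Comparison of the two dynamic programming steps. -/
theorem abs_avgStep_sub_discStep_le {g : Ω → ℝ} (hg : ∀ ω, g ω ∈ Icc (0 : ℝ) 1) {μ : ℝ}
    (h0 : 0 < μ) (h1 : μ < 1) {n h : ℕ} (hn : 1 ≤ n) {v w : Ω → ℝ}
    (hw : ∀ ω, w ω ∈ Icc (0 : ℝ) 1) {S : ℝ} (hS : ∀ ω, |v ω - w ω| ≤ S) (z : K) :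
    |avgStep K g n h v z - discStep K g μ h w z| ≤
      n / (n + h) * S + 2 * (h * |μ - 1 / (n + h)| + (h * μ) ^ 2) := by
  have hW := sum_abs_disc_weight_sub_le h0 h1 (1 / ((n : ℝ) + h)) h
  set E := (h : ℝ) * |μ - 1 / (n + h)| + (h * μ) ^ 2
  have hm : (0 : ℝ) < n + h := by positivity
  -- Both weight systems have total mass 1, so the mismatch of continuation weights equals that of
  -- the stage weights; each costs `E`, hence the factor 2.
  have hgeom : ∑ t ∈ Finset.range h, (μ * (1 - μ) ^ t - 1 / ((n : ℝ) + h)) =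
      n / (n + h) - (1 - μ) ^ h := by
    have := mul_neg_geom_sum (1 - μ) h
    rw [sub_sub_cancel] at this
    rw [Finset.sum_sub_distrib, ← Finset.mul_sum, this]
    simp
    field_simp
    ring
  have hA : |∑ t ∈ Finset.range h,
      (μ * (1 - μ) ^ t - 1 / ((n : ℝ) + h)) * g (z.1 (t : ℝ≥0))| ≤ E := by
    refine (Finset.abs_sum_le_sum_abs _ _).trans (le_trans (Finset.sum_le_sum ?_) hW)
    intro t _
    rw [abs_mul, abs_of_nonneg (hg _).1]
    exact mul_le_of_le_one_right (abs_nonneg _) (hg _).2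
  have hB : |((n : ℝ) / (n + h) - (1 - μ) ^ h) * w (z.1 (h : ℝ≥0))| ≤ E := by
    rw [abs_mul, abs_of_nonneg (hw _).1, ← hgeom]
    exact (mul_le_of_le_one_right (abs_nonneg _) (hw _).2).trans
      ((Finset.abs_sum_le_sum_abs _ _).trans hW)
  have hD : |(n : ℝ) / (n + h) * (v (z.1 (h : ℝ≥0)) - w (z.1 (h : ℝ≥0)))| ≤
      n / (n + h) * S := by
    rw [abs_mul, abs_of_nonneg (by positivity : (0 : ℝ) ≤ n / (n + h))]
    exact mul_le_mul_of_nonneg_left (hS _) (by positivity)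
  have heq : avgStep K g n h v z - discStep K g μ h w z =
      (n : ℝ) / (n + h) * (v (z.1 (h : ℝ≥0)) - w (z.1 (h : ℝ≥0)))
      + ((n : ℝ) / (n + h) - (1 - μ) ^ h) * w (z.1 (h : ℝ≥0))
      - ∑ t ∈ Finset.range h,
        (μ * (1 - μ) ^ t - 1 / ((n : ℝ) + h)) * g (z.1 (t : ℝ≥0)) := by
    simp only [avgStep, discStep, sub_mul, Finset.sum_sub_distrib, Finset.mul_sum, mul_assoc]
    ring
  rw [heq, abs_le]
  rw [abs_le] at hA hB hD
  constructor <;> linarith [hA.1, hA.2, hB.1, hB.2, hD.1, hD.2]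

end Value

/-! ### Contraction and the two Tauberian implications -/

section Comparison

/-- The inequality linking averaged and discounted values that the dynamic programming
principles yield. -/
def StepComparison {Ω : Type*} (v : ℕ → Ω → ℝ) (w : ℝ → Ω → ℝ) : Prop :=
  ∀ n h : ℕ, 1 ≤ n → 1 ≤ h → ∀ μ : ℝ, 0 < μ → μ < 1 → ∀ S : ℝ,
    (∀ ω, |v n ω - w μ ω| ≤ S) → ∀ ω, |v (n + h) ω - w μ ω| ≤
      n / (n + h) * S + 2 * (h * |μ - 1 / (n + h)| + (h * μ) ^ 2)

variable {Ω : Type*} {v : ℕ → Ω → ℝ} {w : ℝ → Ω → ℝ}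

/-- The comparison inequality for steps whose length is a fixed fraction of the horizon. -/
theorem StepComparison.contraction (H : StepComparison v w) {p m : ℕ} (hp : 2 ≤ p) (hm : p ≤ m)
    {μ : ℝ} (h0 : 0 < μ) (hμm : μ ≤ 1 / m) (hmμ : 1 / m - μ ≤ μ / m) (hμp : μ ≤ 1 / p) {S : ℝ}
    (hS0 : 0 ≤ S) (hS : ∀ ω, |v (m - m / p) ω - w μ ω| ≤ S) (ω : Ω) :
    |v m ω - w μ ω| ≤ (1 - 1 / (2 * p)) * S + 4 / p ^ 2 := by
  have hp0 : (0 : ℝ) < p := by positivity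
  have hm0 : (0 : ℝ) < m := by exact_mod_cast (by omega : 0 < m)
  have hh : 1 ≤ m / p := (Nat.one_le_div_iff (by omega)).2 hm
  have hlt : m / p < m := Nat.div_lt_self (by omega) (by omega)
  have hub : m / p * p ≤ m := Nat.div_mul_le_self m p
  -- Rounding down loses at most a factor 2 because p ≤ m; this is the 2 in 1/(2p).
  have hlb : m ≤ 2 * (m / p * p) := by
    have h1 := Nat.div_add_mod m p
    have h2 := Nat.mod_lt m (by omega : 0 < p)
    have h3 : p ≤ m / p * p := Nat.le_mul_of_pos_left p hh
    rw [mul_comm] at h1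
    omega
  have hsum : m - m / p + m / p = m := Nat.sub_add_cancel hlt.le
  have hμ1 : μ < 1 := hμp.trans_lt <| by
    rw [div_lt_one hp0]; exact_mod_cast (by omega : 1 < p)
  have key := H (m - m / p) (m / p) (by omega) hh μ h0 hμ1 S hS ω
  rw [hsum] at key
  set h : ℕ := m / p
  have hcast : ((m - h : ℕ) : ℝ) = m - h := Nat.cast_sub hlt.le
  have hub' : (h : ℝ) * p ≤ m := by exact_mod_cast hub
  have hlb' : (m : ℝ) ≤ 2 * (h * p) := by exact_mod_cast hlb
  rw [hcast, sub_add_cancel] at key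
  have hq1 : (h : ℝ) / m ≤ 1 / p := by rw [div_le_div_iff₀ hm0 hp0]; linarith
  have hq2 : 1 / (2 * p) ≤ (h : ℝ) / m := by
    rw [div_le_div_iff₀ (by positivity) hm0]; linarith
  have hq0 : 0 ≤ (h : ℝ) / m := by positivity
  have e1 : ((m : ℝ) - h) / m * S ≤ (1 - 1 / (2 * p)) * S := by
    rw [sub_div, div_self hm0.ne']
    exact mul_le_mul_of_nonneg_right (by linarith) hS0
  have e2 : (h : ℝ) * |μ - 1 / m| ≤ 1 / p ^ 2 := by
    rw [abs_sub_comm, abs_of_nonneg (by linarith)]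
    calc (h : ℝ) * (1 / m - μ) ≤ h * (μ / m) := by gcongr
      _ = h / m * μ := by ring
      _ ≤ 1 / p * (1 / p) := by gcongr
      _ = 1 / p ^ 2 := by ring
  have e3 : ((h : ℝ) * μ) ^ 2 ≤ 1 / p ^ 2 := by
    calc ((h : ℝ) * μ) ^ 2 ≤ ((h : ℝ) * (1 / m)) ^ 2 := by gcongr
      _ = ((h : ℝ) / m) ^ 2 := by ring
      _ ≤ (1 / (p : ℝ)) ^ 2 := by gcongr
      _ = 1 / p ^ 2 := by ring
  calc _ ≤ _ := key
    _ ≤ (1 - 1 / (2 * p)) * S + 2 * (1 / p ^ 2 + 1 / p ^ 2) := by gcongr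
    _ = _ := by ring

theorem sub_div_tendsto_atTop {p : ℕ} (hp : 2 ≤ p) :
    Tendsto (fun m : ℕ => m - m / p) atTop atTop := by
  refine tendsto_atTop.2 fun b => ?_
  filter_upwards [eventually_ge_atTop (2 * b)] with m hm
  have : m / p ≤ m / 2 := Nat.div_le_div_left hp (by norm_num)
  omega

theorem exists_ten_div_lt {ε : ℝ} (hε : 0 < ε) : ∃ p : ℕ, 2 ≤ p ∧ 10 / (p : ℝ) < ε := by
  obtain ⟨p, hp⟩ := exists_nat_gt (max 2 (10 / ε))
  have h2 : (2 : ℝ) < p := (le_max_left _ _).trans_lt hp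
  refine ⟨p, by exact_mod_cast h2.le, ?_⟩
  rw [div_lt_comm₀ (by linarith) hε]
  exact (le_max_right _ _).trans_lt hp

theorem tendsto_nat_floor_inv : Tendsto (fun μ : ℝ => ⌊μ⁻¹⌋₊) (𝓝[>] 0) atTop :=
  tendsto_nat_floor_atTop.comp tendsto_inv_nhdsGT_zero

/-- Uniform convergence of the averaged values yields that of the discounted values. -/
theorem StepComparison.tendstoUniformly_disc [Nonempty Ω] (H : StepComparison v w)
    (hv : ∀ n, 1 ≤ n → ∀ ω, v n ω ∈ Icc (0 : ℝ) 1)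
    (hw : ∀ μ, 0 < μ → μ < 1 → ∀ ω, w μ ω ∈ Icc (0 : ℝ) 1) {U : Ω → ℝ}
    (hU : TendstoUniformly v U atTop) : TendstoUniformly w U (𝓝[>] 0) := by
  rw [Metric.tendstoUniformly_iff] at hU ⊢
  intro ε hε
  obtain ⟨p, hp, hpε⟩ := exists_ten_div_lt (half_pos hε)
  have hp0 : (0 : ℝ) < p := by positivity
  have hδ : (0 : ℝ) < 1 / (2 * p ^ 2) := by positivity
  have hfl := tendsto_nat_floor_inv
  filter_upwards [hfl.eventually (hU _ hδ), hfl.eventually (hU _ (half_pos hε)),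
    hfl.eventually ((sub_div_tendsto_atTop hp).eventually (hU _ hδ)),
    hfl.eventually (eventually_ge_atTop p), self_mem_nhdsWithin] with μ c1 c2 c3 hm h0 ω
  rw [mem_Ioi] at h0
  -- This choice gives 0 ≤ 1/m − μ ≤ μ/m.
  set m := ⌊μ⁻¹⌋₊
  have hm0 : (0 : ℝ) < m := by exact_mod_cast (by omega : 0 < m)
  have hpm : (p : ℝ) ≤ m := by exact_mod_cast hm
  have hle : (m : ℝ) ≤ μ⁻¹ := Nat.floor_le (by positivity)
  have hlt : μ⁻¹ < m + 1 := Nat.lt_floor_add_one _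
  have hmul : (m : ℝ) * μ ≤ 1 := by
    calc (m : ℝ) * μ ≤ μ⁻¹ * μ := by gcongr
      _ = 1 := inv_mul_cancel₀ h0.ne'
  have hmul2 : 1 < (m + 1) * μ := by
    calc 1 = μ⁻¹ * μ := (inv_mul_cancel₀ h0.ne').symm
      _ < (m + 1) * μ := by gcongr
  have hμm : μ ≤ 1 / m := by rw [le_div_iff₀ hm0]; linarith
  have hmμ : 1 / m - μ ≤ μ / m := by
    rw [sub_le_iff_le_add, div_add' _ _ _ hm0.ne']
    gcongr
    linarith
  have hμp : μ ≤ 1 / p := hμm.trans (by gcongr)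
  have hμ1 : μ < 1 := hμp.trans_lt <| by
    rw [div_lt_one hp0]; exact_mod_cast (by omega : 1 < p)
  have hbdd : BddAbove (range fun ω => |v m ω - w μ ω|) := by
    refine ⟨1, ?_⟩
    rintro _ ⟨ω, rfl⟩
    have h1 := hv m (by omega) ω
    have h2 := hw μ h0 hμ1 ω
    exact abs_le.2 ⟨by linarith [h1.1, h2.2], by linarith [h1.2, h2.1]⟩
  set S := ⨆ ω, |v m ω - w μ ω|
  have hSle : ∀ ω, |v m ω - w μ ω| ≤ S := fun ω => le_ciSup hbdd ω
  have hS0 : 0 ≤ S := (abs_nonneg _).trans (hSle ω)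
  have hstep : ∀ ω, |v (m - m / p) ω - w μ ω| ≤ S + 1 / p ^ 2 := by
    intro ω
    have d1 := c1 ω
    have d3 := c3 ω
    rw [Real.dist_eq, abs_lt] at d1 d3
    have d2 := abs_le.1 (hSle ω)
    have e : (1 : ℝ) / p ^ 2 = 2 * (1 / (2 * p ^ 2)) := by field_simp
    rw [e, abs_le]
    constructor <;> linarith [d1.1, d1.2, d3.1, d3.2, d2.1, d2.2]
  -- Since the averaged values at m − ⌊m/p⌋ and m are within 1/p², the supremum `S` bounds itself:
  -- S/(2p) ≤ 5/p², so S ≤ 10/p.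
  have hS : S ≤ (1 - 1 / (2 * p)) * (S + 1 / p ^ 2) + 4 / p ^ 2 :=
    ciSup_le (H.contraction hp hm h0 hμm hmμ hμp (by positivity) hstep)
  have hS2 : S ≤ 10 / p := by
    have h3 : 1 / (2 * p) * S ≤ 5 / p ^ 2 := by
      have : (0 : ℝ) ≤ 1 / (2 * p) * (1 / p ^ 2) := by positivity
      have e : (5 : ℝ) / p ^ 2 = 1 / p ^ 2 + 4 / p ^ 2 := by ring
      rw [e]
      linarith
    calc S = 2 * p * (1 / (2 * p) * S) := by field_simp
      _ ≤ 2 * p * (5 / p ^ 2) := by gcongr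
      _ = 10 / p := by field_simp; norm_num
  have d2 := c2 ω
  have d4 := abs_le.1 (hSle ω)
  rw [Real.dist_eq, abs_lt] at d2 ⊢
  constructor <;> linarith [d2.1, d2.2, d4.1, d4.2]

theorem tendsto_one_div_nat_nhdsGT_zero :
    Tendsto (fun m : ℕ => 1 / (m : ℝ)) atTop (𝓝[>] 0) := by
  refine tendsto_nhdsWithin_iff.2 ⟨tendsto_one_div_atTop_nhds_zero_nat, ?_⟩
  filter_upwards [eventually_gt_atTop 0] with m hm
  have : (0 : ℝ) < m := by exact_mod_cast hm
  exact one_div_pos.2 this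

/-- Uniform convergence of the discounted values yields that of the averaged values. -/
theorem StepComparison.tendstoUniformly_avg (H : StepComparison v w)
    (hv : ∀ n, 1 ≤ n → ∀ ω, v n ω ∈ Icc (0 : ℝ) 1)
    (hw : ∀ μ, 0 < μ → μ < 1 → ∀ ω, w μ ω ∈ Icc (0 : ℝ) 1) {U : Ω → ℝ}
    (hU : TendstoUniformly w U (𝓝[>] 0)) : TendstoUniformly v U atTop := by
  rw [Metric.tendstoUniformly_iff] at hU ⊢
  intro ε hε
  obtain ⟨p, hp, hpε⟩ := exists_ten_div_lt (half_pos hε)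
  have hp0 : (0 : ℝ) < p := by positivity
  have hδ : (0 : ℝ) < 1 / (2 * p ^ 2) := by positivity
  have hinv := tendsto_one_div_nat_nhdsGT_zero
  have hsub := sub_div_tendsto_atTop hp
  have hr1 : (1 : ℝ) / (2 * p) < 1 := by
    rw [div_lt_one (by positivity)]; exact_mod_cast (by omega : 1 < 2 * p)
  have hr0 : (0 : ℝ) < 1 / (2 * p) := by positivity
  -- Averaged values at nearby horizons are not yet known to be close, so no self-bound is
  -- available; the contraction is iterated instead, from the trivial bound 1 towards the fixed
  -- point 10/p.
  have iter : ∀ k : ℕ, ∀ᶠ m : ℕ in atTop, ∀ ω,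
      |v m ω - w (1 / m) ω| ≤ (1 - 1 / (2 * p)) ^ k + 10 / p := by
    intro k
    induction k with
    | zero =>
      filter_upwards [eventually_ge_atTop 2] with m hm ω
      have hm1 : (1 : ℝ) < m := by exact_mod_cast (by omega : 1 < m)
      have h1 := hv m (by omega) ω
      have h2 := hw (1 / m) (by positivity) ((div_lt_one (by linarith)).2 hm1) ω
      have : (0 : ℝ) ≤ 10 / p := by positivity
      rw [pow_zero, abs_le]
      constructor <;> linarith [h1.1, h1.2, h2.1, h2.2]
    | succ k ih =>
      filter_upwards [hsub.eventually ih, hinv.eventually (hU _ hδ),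
        hsub.eventually (hinv.eventually (hU _ hδ)), eventually_ge_atTop p] with m c1 c2 c3 hm ω
      have hm0 : (0 : ℝ) < m := by exact_mod_cast (by omega : 0 < m)
      have hpm : (p : ℝ) ≤ m := by exact_mod_cast hm
      have hR : (0 : ℝ) ≤ (1 - 1 / (2 * p)) ^ k := pow_nonneg (by linarith) k
      have hstep : ∀ ω, |v (m - m / p) ω - w (1 / m) ω| ≤
          (1 - 1 / (2 * p)) ^ k + 10 / p + 1 / p ^ 2 := by
        intro ω
        have d1 := abs_le.1 (c1 ω)
        have d2 := c2 ω
        have d3 := c3 ω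
        rw [Real.dist_eq, abs_lt] at d2 d3
        have e : (1 : ℝ) / p ^ 2 = 2 * (1 / (2 * p ^ 2)) := by field_simp
        rw [e, abs_le]
        constructor <;> linarith [d1.1, d1.2, d2.1, d2.2, d3.1, d3.2]
      refine (H.contraction hp hm (by positivity) le_rfl ?_ (by gcongr) (by positivity)
        hstep ω).trans ?_
      · rw [sub_self]; positivity
      · have : (0 : ℝ) ≤ 1 / (2 * p) * (1 / p ^ 2) := by positivity
        -- The contraction of the term 10/p exactly absorbs the discount shift 1/p² and the step
        -- error 4/p².
        have e : (1 : ℝ) / (2 * p) * (10 / p) = 1 / p ^ 2 + 4 / p ^ 2 := by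
          field_simp; norm_num
        rw [pow_succ _ k]
        linarith
  obtain ⟨k, hk⟩ := exists_pow_lt_of_lt_one (sub_pos.2 hpε) (by linarith : 1 - 1 / (2 * p) < (1 : ℝ))
  filter_upwards [iter k, hinv.eventually (hU _ (half_pos hε))] with m c1 c2 ω
  have d1 := abs_le.1 (c1 ω)
  have d2 := c2 ω
  rw [Real.dist_eq, abs_lt] at d2 ⊢
  constructor <;> linarith [d1.1, d1.2, d2.1, d2.2]

end Comparison

end TauberianGame

theorem theorem3 {Ω : Type*} [Nonempty Ω]
    (K : Set (ℝ≥0 → Ω)) (hK : K.Nonempty)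
    (hKd : ∀ z ∈ K, TauberianGame.IsDiscreteProcess z)
    (g : Ω → ℝ) (hg : ∀ ω, g ω ∈ Set.Icc (0 : ℝ) 1)
    (C : Set (K → ℝ)) (hC : TauberianGame.IsPayoffClass C)
    (V : (K → ℝ) → Ω → ℝ) (hV : TauberianGame.IsGameValueMap C V)
    (hvC : ∀ n : ℕ, 1 ≤ n → TauberianGame.avgPayoff K g n ∈ C)
    (hwC : ∀ μ : ℝ, 0 < μ → μ < 1 → TauberianGame.discPayoff K g μ ∈ C)
    (hvDPP : TauberianGame.AvgDPP g C V)
    (hwDPP : TauberianGame.DiscDPP g C V) :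
    ((∃ U : Ω → ℝ, TendstoUniformly (fun n : ℕ => V (TauberianGame.avgPayoff K g n)) U atTop) ↔
      (∃ U : Ω → ℝ,
        TendstoUniformly (fun μ : ℝ => V (TauberianGame.discPayoff K g μ)) U (𝓝[>] 0))) ∧
    (((∃ U : Ω → ℝ, TendstoUniformly (fun n : ℕ => V (TauberianGame.avgPayoff K g n)) U atTop) ∨
      (∃ U : Ω → ℝ,
        TendstoUniformly (fun μ : ℝ => V (TauberianGame.discPayoff K g μ)) U (𝓝[>] 0))) →
      ∀ ω : Ω, ∃ L : ℝ,
        Tendsto (fun n : ℕ => V (TauberianGame.avgPayoff K g n) ω) atTop (𝓝 L) ∧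
        Tendsto (fun μ : ℝ => V (TauberianGame.discPayoff K g μ) ω) (𝓝[>] 0) (𝓝 L)) := by
  have hv : ∀ n, 1 ≤ n → ∀ ω, V (TauberianGame.avgPayoff K g n) ω ∈ Set.Icc (0 : ℝ) 1 :=
    fun n hn => hV.mem_Icc hC (hvC n hn) (TauberianGame.avgPayoff_mem_Icc hg n)
  have hw : ∀ μ, 0 < μ → μ < 1 → ∀ ω, V (TauberianGame.discPayoff K g μ) ω ∈ Set.Icc (0 : ℝ) 1 :=
    fun μ h0 h1 => hV.mem_Icc hC (hwC μ h0 h1) (TauberianGame.discPayoff_mem_Icc hg h0 h1)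
  have H : TauberianGame.StepComparison (fun n => V (TauberianGame.avgPayoff K g n))
      (fun μ => V (TauberianGame.discPayoff K g μ)) := by
    intro n h hn hh μ h0 h1 S hS
    obtain ⟨m₁, e₁⟩ := hvDPP n h hn hh
    obtain ⟨m₂, e₂⟩ := hwDPP μ h0 h1 h hh
    -- Nonexpansiveness carries the pointwise bound on step payoffs to their values, which the
    -- dynamic programming principles identify.
    have := hV.abs_sub_le hC m₁ m₂
      (TauberianGame.abs_avgStep_sub_discStep_le hg h0 h1 hn (hw μ h0 h1) hS)
    rwa [e₁, e₂] at this
  have h12 := fun U => H.tendstoUniformly_disc hv hw (U := U)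
  have h21 := fun U => H.tendstoUniformly_avg hv hw (U := U)
  refine ⟨⟨fun ⟨U, hU⟩ => ⟨U, h12 U hU⟩, fun ⟨U, hU⟩ => ⟨U, h21 U hU⟩⟩, ?_⟩
  rintro (⟨U, hU⟩ | ⟨U, hU⟩) ω
  · exact ⟨U ω, hU.tendsto_at ω, (h12 U hU).tendsto_at ω⟩
  · exact ⟨U ω, (h21 U hU).tendsto_at ω, hU.tendsto_at ω⟩
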